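/- Let $0<\mu_1<\mu_2<\cdots$ be a sequence of real numbers such that: (A1) for certain $M>0$, $\beta>1$ and $\sigma\in(0,1]$, $\mu_n = M n^{\beta}\bigl(1+o(n^{-\sigma})\bigr)$ as $n\to\infty$; (A2) for certain $\theta>0$ and $s\ge 0$, $\mu_{n+1}-\mu_n\ge \theta n^{-s}$ for every $n\ge 1$. For $T>0$ let $r_n$ be the point nearest to $e^{-\mu_n t}$ in the closed linear span of $\{e^{-\mu_k t}: k\ne n\}$ in $L^2[0,T]$ (real or complex scalars), put $d_n(T)=\|e^{-\mu_n t}-r_n\|_{L^2[0,T]}$ and let $\varphi_n = d_n(T)^{-2}\,(e^{-\mu_n t}-r_n)$ be the optimal bi-orthogonal functions. Then there are constants $K_0,K_2>0$, independent of $n$ and $T$, such that for every $T>0$ the following hold. 1. $\int_0^T e^{-\mu_n t}\varphi_k(t)\,dt=\delta_{kn}$ for all $k,n\ge 1$ (in particular $\varphi_n$ is well defined). 2. There is $\kappa=\kappa(T)>0$, independent of $n$, with $$\|\varphi_n\|_{L^2[0,T]}\le \kappa(T)\sqrt{\tfrac{\mu_n}{2}}\,\exp\!\bigl(K_0M^{-1/\beta}\mu_n^{1/\beta}(\log\mu_n+K_2)\bigr)\qquad(n\ge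 1).$$ 3. For every sequence of scalars $(m_n)_{n\ge 1}$ with $$\sum_{n=1}^{\infty}|m_n|\sqrt{\mu_n}\,\exp\!\bigl(K_0M^{-1/\beta}\mu_n^{1/\beta}(\log\mu_n+K_2)\bigr)<\infty,$$ the series $\sum_{n} m_n\varphi_n$ converges absolutely in $L^2[0,T]$, that is, $\sum_n|m_n|\,\|\varphi_n\|_{L^2[0,T]}<\infty$, and its sum $\nu\in L^2[0,T]$ solves the exponential moment problem $$\int_0^T e^{-\mu_n t}\nu(t)\,dt=m_n\qquad\text{for all } n\ge 1.$$ -/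

import Mathlib

open MeasureTheory

noncomputable section

namespace ExpMoment

/-! Sequences are indexed from `0`: `μ n` is the eigenvalue usually written `μ_{n+1}`, so that
the factor usually written `n ^ β` reads `(n + 1) ^ β`, and similarly for `m`, `φ`. -/

/-- Growth: `μ_n = M n^β (1 + o(n^{-σ}))` for a certain `σ ∈ (0, 1]`. -/
def Growth (μ : ℕ → ℝ) (M β : ℝ) : Prop :=
  ∃ σ : ℝ, 0 < σ ∧ σ ≤ 1 ∧ ∃ ε : ℕ → ℝ,
    (∀ n : ℕ, μ n = M * ((n : ℝ) + 1) ^ β * (1 + ε n)) ∧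
    ε =o[Filter.atTop] (fun n : ℕ => ((n : ℝ) + 1) ^ (-σ))

/-- Gaps: `μ_{n+1} - μ_n ≥ θ n^{-s}` for all `n ≥ 1`, for certain `θ > 0` and `s ≥ 0`. -/
def Gap (μ : ℕ → ℝ) : Prop :=
  ∃ θ s : ℝ, 0 < θ ∧ 0 ≤ s ∧ ∀ n : ℕ, θ * ((n : ℝ) + 1) ^ (-s) ≤ μ (n + 1) - μ n

/-- The Hilbert space `L²[0, T]` of real or complex functions. -/
abbrev L2 (𝕜 : Type*) [RCLike 𝕜] (T : ℝ) : Type _ :=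
  Lp 𝕜 2 (volume.restrict (Set.Icc (0 : ℝ) T))

theorem memLp_exp (𝕜 : Type*) [RCLike 𝕜] (T a : ℝ) :
    MemLp (fun t : ℝ => ((Real.exp (-a * t) : ℝ) : 𝕜)) 2
      (volume.restrict (Set.Icc (0 : ℝ) T)) := by
  have hc : Continuous (fun t : ℝ => ((Real.exp (-a * t) : ℝ) : 𝕜)) := by fun_prop
  obtain ⟨C, hC⟩ := isCompact_Icc.exists_bound_of_continuousOn
    (hc.continuousOn (s := Set.Icc (0 : ℝ) T))
  refine MemLp.of_bound hc.aestronglyMeasurable C ?_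
  exact (ae_restrict_iff' measurableSet_Icc).2 (Filter.Eventually.of_forall hC)

/-- The function `t ↦ e^{-a t}` as an element of `L²[0, T]`. -/
def expL2 (𝕜 : Type*) [RCLike 𝕜] (T a : ℝ) : L2 𝕜 T := (memLp_exp 𝕜 T a).toLp _

/-- The smallest closed subspace of `L²[0, T]` containing all `e^{-μ_k t}` with `k ≠ n`. -/
def closedSpanOthers (𝕜 : Type*) [RCLike 𝕜] (μ : ℕ → ℝ) (T : ℝ) (n : ℕ) :
    Submodule 𝕜 (L2 𝕜 T) :=
  (Submodule.span 𝕜 ((fun k => expL2 𝕜 T (μ k)) '' {k | k ≠ n})).topologicalClosure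

instance hasOrthogonalProjection_closedSpanOthers (𝕜 : Type*) [RCLike 𝕜] (μ : ℕ → ℝ) (T : ℝ) (n : ℕ) :
    (closedSpanOthers 𝕜 μ T n).HasOrthogonalProjection := by
  unfold closedSpanOthers
  infer_instance

/-- `e^{-μ_n t} - r_n`, where `r_n`, the orthogonal projection of `e^{-μ_n t}`, is the point of
`closedSpanOthers 𝕜 μ T n` nearest to `e^{-μ_n t}`. -/
def residual (𝕜 : Type*) [RCLike 𝕜] (μ : ℕ → ℝ) (T : ℝ) (n : ℕ) : L2 𝕜 T :=
  expL2 𝕜 T (μ n) - (closedSpanOthers 𝕜 μ T n).starProjection (expL2 𝕜 T (μ n))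

/-- The optimal bi-orthogonal function `φ_n = (e^{-μ_n t} - r_n) / d_n(T)^2`, where
`d_n(T) = ‖e^{-μ_n t} - r_n‖`. -/
def phi (𝕜 : Type*) [RCLike 𝕜] (μ : ℕ → ℝ) (T : ℝ) (n : ℕ) : L2 𝕜 T :=
  (((‖residual 𝕜 μ T n‖ ^ 2)⁻¹ : ℝ) : 𝕜) • residual 𝕜 μ T n

/-- The moment `∫_0^T e^{-a t} f(t) dt`. -/
def expIntegral {𝕜 : Type*} [RCLike 𝕜] {T : ℝ} (a : ℝ) (f : L2 𝕜 T) : 𝕜 :=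
  ∫ t in Set.Icc (0 : ℝ) T, ((Real.exp (-a * t) : ℝ) : 𝕜) * f t

/-- The weight `√μ_n exp(K₀ M^{-1/β} μ_n^{1/β} (log μ_n + K₂))`. -/
def weight (μ : ℕ → ℝ) (M β K₀ K₂ : ℝ) (n : ℕ) : ℝ :=
  Real.sqrt (μ n) *
    Real.exp (K₀ * M ^ (-(1 / β)) * μ n ^ (1 / β) * (Real.log (μ n) + K₂))

end ExpMoment

end

/-!
The heart of the matter is a lower bound for the distance from `e^{-μ_n t}` to the span of the
other exponentials in `L²(0, T)`: the inverse of that distance is `‖φ_n‖`. Equivalently, the `n`-th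
coefficient of an exponential polynomial `P = ∑ a_k e^{-μ_k t}` has to be bounded by its norm. As
taking real parts decreases norms and commutes with reading off coefficients, real coefficients
suffice.

On the half line the bound is Müntz's (`coeff_sq_le`): the Gram matrix of the exponentials is the
Cauchy matrix `1 / (μ_i + μ_k)`, a column of its inverse is found by Lagrange interpolation
(`exists_cauchy_dual`), and so `|a_n| ≤ √(2 μ_n) ∏_{k ≠ n} |(μ_n + μ_k) / (μ_n - μ_k)| ‖P‖`. The gap
condition and `μ_n ≍ n^β` with `β > 1` bound the product by `e^{O(n log n)}` (`exists_prod_le`),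
which `exists_le_weight_exponent` writes as the exponential factor of `weight`. The constants `K₀`
and `K₂` arise here, before `T` is chosen.

Passing from `(0, ∞)` to `(0, T)` costs a factor that depends on `T` only (Schwartz's inequality,
`exists_integral_Ioi_le`). It is proved by compactness. The coefficients of a sequence of
polynomials, normalised on the half line, are `e^{O(n log n)}`, which `e^{-μ_n t}` beats for every
`t > 0`; hence a subsequence converges to a Dirichlet series, analytic for `Re z > 0`, uniformly
enough to pass to the limit in the integrals over `(T / 2, ∞)`. If the norms over `(0, T)` tend
to `0`, the limit vanishes on `(T / 2, T)`, hence everywhere, and then the norms over `(0, ∞)` tend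
to `0` as well.

Biorthogonality is orthogonality of the residual to the closed span of the other exponentials, and
the moment problem follows by continuity of the moments on `L²`.
-/

namespace ExpMoment

/-! ### Exponential polynomials on the half line -/

/-- The exponential polynomial `∑ a_k e^{-μ_k t}` with finitely supported real coefficients. -/
noncomputable def expPoly (μ : ℕ → ℝ) (a : ℕ →₀ ℝ) (t : ℝ) : ℝ :=
  ∑ k ∈ a.support, a k * Real.exp (-μ k * t)

theorem expPoly_eq_sum_of_subset (μ : ℕ → ℝ) (a : ℕ →₀ ℝ) {F : Finset ℕ} (h : a.support ⊆ F)
    (t : ℝ) : expPoly μ a t = ∑ k ∈ F, a k * Real.exp (-μ k * t) := by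
  refine Finset.sum_subset h fun k _ hk => ?_
  simp [Finsupp.notMem_support_iff.1 hk]

theorem continuous_expPoly (μ : ℕ → ℝ) (a : ℕ →₀ ℝ) : Continuous (expPoly μ a) := by
  unfold expPoly
  fun_prop

theorem integrableOn_mul_exp {x y : ℝ} (hx : 0 < x) (hy : 0 < y) (c d : ℝ) :
    IntegrableOn (fun t => (c * Real.exp (-x * t)) * (d * Real.exp (-y * t))) (Set.Ioi 0) := by
  have h := (exp_neg_integrableOn_Ioi 0 (add_pos hx hy)).const_mul (c * d)
  refine h.congr (Filter.Eventually.of_forall fun t => ?_)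
  simp only
  rw [show -(x + y) * t = -x * t + -y * t by ring, Real.exp_add]
  ring

theorem integral_mul_exp {x y : ℝ} (hx : 0 < x) (hy : 0 < y) (c d : ℝ) :
    ∫ t in Set.Ioi (0 : ℝ), (c * Real.exp (-x * t)) * (d * Real.exp (-y * t)) =
      c * d / (x + y) := by
  have h : ∀ t : ℝ, (c * Real.exp (-x * t)) * (d * Real.exp (-y * t)) =
      (c * d) * Real.exp (-(x + y) * t) := fun t => by
    rw [show -(x + y) * t = -x * t + -y * t by ring, Real.exp_add]
    ring
  simp_rw [h]
  rw [integral_const_mul, integral_exp_mul_Ioi (by linarith) 0]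
  rw [mul_zero, Real.exp_zero, neg_div_neg_eq, mul_one_div]

theorem integrableOn_sq_sum_exp {x : ℕ → ℝ} (F : Finset ℕ) (hx : ∀ k ∈ F, 0 < x k) (b : ℕ → ℝ) :
    IntegrableOn (fun t => (∑ k ∈ F, b k * Real.exp (-x k * t)) ^ 2) (Set.Ioi 0) := by
  simp_rw [sq, Finset.sum_mul_sum]
  exact integrable_finsetSum _ fun i hi => integrable_finsetSum _ fun j hj =>
    integrableOn_mul_exp (hx i hi) (hx j hj) _ _

theorem integral_sq_sum_exp {x : ℕ → ℝ} (F : Finset ℕ) (hx : ∀ k ∈ F, 0 < x k) (b : ℕ → ℝ) :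
    ∫ t in Set.Ioi (0 : ℝ), (∑ k ∈ F, b k * Real.exp (-x k * t)) ^ 2 =
      ∑ i ∈ F, ∑ j ∈ F, b i * b j / (x i + x j) := by
  simp_rw [sq, Finset.sum_mul_sum]
  rw [integral_finsetSum _ fun i hi => integrable_finsetSum _ fun j hj =>
    integrableOn_mul_exp (hx i hi) (hx j hj) _ _]
  refine Finset.sum_congr rfl fun i hi => ?_
  rw [integral_finsetSum _ fun j hj => integrableOn_mul_exp (hx i hi) (hx j hj) _ _]
  exact Finset.sum_congr rfl fun j hj => integral_mul_exp (hx i hi) (hx j hj) _ _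

theorem integrableOn_expPoly_sq {μ : ℕ → ℝ} (hμ : ∀ k, 0 < μ k) (a : ℕ →₀ ℝ) :
    IntegrableOn (fun t => expPoly μ a t ^ 2) (Set.Ioi 0) :=
  integrableOn_sq_sum_exp _ (fun k _ => hμ k) _

/-- Inversion of a column of the Cauchy matrix `1 / (x_i + x_k)`: the coefficients are the residues
of the rational function with poles `-x_i` and zeros `x_k`, `k ≠ n`, that takes the value `1` at
`x_n`. -/
theorem exists_cauchy_dual {x : ℕ → ℝ} (F : Finset ℕ) (hx : ∀ k ∈ F, 0 < x k)
    (hinj : Set.InjOn x F) {n : ℕ} (hn : n ∈ F) :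
    ∃ c : ℕ → ℝ, (∀ k ∈ F, ∑ i ∈ F, c i / (x i + x k) = if k = n then 1 else 0) ∧
      c n = 2 * x n * ∏ k ∈ F.erase n, ((x n + x k) / (x n - x k)) ^ 2 := by
  classical
  have hne : ∀ k ∈ F.erase n, x n - x k ≠ 0 := fun k hk h => by
    rw [Finset.mem_erase] at hk
    exact hk.1 (hinj hk.2 hn (by linarith))
  set v : ℕ → ℝ := fun k => -x k with hv
  have hvinj : Set.InjOn v F := fun i hi j hj h => hinj hi hj (neg_injective h)
  set A : ℝ := (∏ k ∈ F, (x n + x k)) / ∏ k ∈ F.erase n, (x n - x k) with hA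
  set Q : Polynomial ℝ := Polynomial.C A * Lagrange.nodal (F.erase n) x with hQ
  have hdeg : Q.degree < F.card := by
    rw [hQ, Polynomial.C_mul']
    refine lt_of_le_of_lt (Polynomial.degree_smul_le _ _) ?_
    rw [Lagrange.degree_nodal, Finset.card_erase_of_mem hn]
    have := Finset.card_pos.2 ⟨n, hn⟩
    exact_mod_cast (by omega : F.card - 1 < F.card)
  have hint := Lagrange.eq_interpolate hvinj hdeg
  refine ⟨fun i => Lagrange.nodalWeight F v i * Q.eval (v i), fun k hk => ?_, ?_⟩
  · have hnode : ∀ i ∈ F, x k ≠ v i := fun i hi h => by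
      have h1 := hx i hi
      have h2 := hx k hk
      simp only [hv] at h
      linarith
    have h := congrArg (Polynomial.eval (x k)) hint
    rw [Lagrange.eval_interpolate_not_at_node _ hnode] at h
    have hsum : ∑ i ∈ F, Lagrange.nodalWeight F v i * (x k - v i)⁻¹ * Polynomial.eval (v i) Q =
        ∑ i ∈ F, Lagrange.nodalWeight F v i * Q.eval (v i) / (x i + x k) := by
      refine Finset.sum_congr rfl fun i _ => ?_
      simp only [hv, sub_neg_eq_add, div_eq_mul_inv, add_comm (x i)]
      ring
    rw [hsum] at h
    have hN : (Lagrange.nodal F v).eval (x k) = ∏ i ∈ F, (x k + x i) := by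
      rw [Lagrange.eval_nodal]
      simp [hv]
    have hNpos : 0 < ∏ i ∈ F, (x k + x i) :=
      Finset.prod_pos fun i hi => add_pos (hx k hk) (hx i hi)
    rw [hN] at h
    have hQk : Q.eval (x k) = if k = n then ∏ i ∈ F, (x k + x i) else 0 := by
      rw [hQ, Polynomial.eval_mul, Polynomial.eval_C, Lagrange.eval_nodal]
      split_ifs with hkn
      · subst hkn
        exact div_mul_cancel₀ _ (Finset.prod_ne_zero_iff.2 hne)
      · rw [Finset.prod_eq_zero (Finset.mem_erase.2 ⟨hkn, hk⟩) (sub_self _), mul_zero]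
    rw [hQk] at h
    split_ifs at h ⊢ with hkn
    · exact mul_left_cancel₀ hNpos.ne' (by rw [← h, mul_one])
    · exact (mul_eq_zero.1 h.symm).resolve_left hNpos.ne'
  · have hw : Lagrange.nodalWeight F v n = ∏ k ∈ F.erase n, (x k - x n)⁻¹ := by
      refine Finset.prod_congr rfl fun k _ => ?_
      simp only [hv]
      congr 1
      ring
    have hQn : Q.eval (v n) = A * ∏ k ∈ F.erase n, (-x n - x k) := by
      rw [hQ, Polynomial.eval_mul, Polynomial.eval_C, Lagrange.eval_nodal]
    simp only
    rw [hw, hQn, hA, ← Finset.mul_prod_erase F _ hn, mul_div_assoc, ← Finset.prod_div_distrib,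
      ← two_mul, mul_left_comm, mul_assoc, mul_assoc, ← Finset.prod_mul_distrib,
      ← Finset.prod_mul_distrib, mul_assoc]
    congr 2
    refine Finset.prod_congr rfl fun k hk => ?_
    have h1 := hne k hk
    have h2 : x k - x n ≠ 0 := fun h => h1 (by linarith)
    field_simp
    ring

/-- Müntz's estimate of a coefficient by the norm in `L²(0, ∞)`. -/
theorem coeff_sq_le {x : ℕ → ℝ} (F : Finset ℕ) (hx : ∀ k ∈ F, 0 < x k)
    (hinj : Set.InjOn x F) {n : ℕ} (hn : n ∈ F) (a : ℕ → ℝ) :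
    a n ^ 2 ≤ (2 * x n * ∏ k ∈ F.erase n, ((x n + x k) / (x n - x k)) ^ 2) *
      ∫ t in Set.Ioi (0 : ℝ), (∑ k ∈ F, a k * Real.exp (-x k * t)) ^ 2 := by
  obtain ⟨c, hc, hcn⟩ := exists_cauchy_dual F hx hinj hn
  have hpos : 0 < c n := by
    rw [hcn]
    refine mul_pos (mul_pos two_pos (hx n hn)) (Finset.prod_pos fun k hk => ?_)
    rw [Finset.mem_erase] at hk
    have h1 : x n - x k ≠ 0 := fun h => hk.1 (hinj hk.2 hn (by linarith))
    have h2 := add_pos (hx n hn) (hx k hk.2)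
    positivity
  rw [← hcn, integral_sq_sum_exp F hx]
  have hB : ∀ b : ℕ → ℝ, ∑ i ∈ F, ∑ j ∈ F, c i * b j / (x i + x j) = b n := fun b => by
    rw [Finset.sum_comm]
    have h : ∀ j ∈ F, ∑ i ∈ F, c i * b j / (x i + x j) = if j = n then b j else 0 := by
      intro j hj
      have := hc j hj
      calc ∑ i ∈ F, c i * b j / (x i + x j) = b j * ∑ i ∈ F, c i / (x i + x j) := by
            rw [Finset.mul_sum]
            exact Finset.sum_congr rfl fun i _ => by ring
        _ = _ := by rw [this]; split_ifs <;> simp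
    rw [Finset.sum_congr rfl h]
    simp [hn]
  have hB' : ∀ b : ℕ → ℝ, ∑ i ∈ F, ∑ j ∈ F, b i * c j / (x i + x j) = b n := fun b => by
    rw [← hB b, Finset.sum_comm]
    exact Finset.sum_congr rfl fun i _ => Finset.sum_congr rfl fun j _ => by
      rw [mul_comm, add_comm]
  -- The square of `P - s G`, with `G` the dual function, has a nonnegative integral.
  set s : ℝ := a n / c n with hs
  have h0 : 0 ≤ ∑ i ∈ F, ∑ j ∈ F, (a i - s * c i) * (a j - s * c j) / (x i + x j) := by
    rw [← integral_sq_sum_exp F hx (fun k => a k - s * c k)]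
    exact integral_nonneg fun t => sq_nonneg _
  have hexp : ∑ i ∈ F, ∑ j ∈ F, (a i - s * c i) * (a j - s * c j) / (x i + x j) =
      (∑ i ∈ F, ∑ j ∈ F, a i * a j / (x i + x j)) - s * (∑ i ∈ F, ∑ j ∈ F, c i * a j / (x i + x j))
      - s * (∑ i ∈ F, ∑ j ∈ F, a i * c j / (x i + x j))
      + s ^ 2 * (∑ i ∈ F, ∑ j ∈ F, c i * c j / (x i + x j)) := by
    simp only [Finset.mul_sum, ← Finset.sum_sub_distrib, ← Finset.sum_add_distrib]
    exact Finset.sum_congr rfl fun i _ => Finset.sum_congr rfl fun j _ => by ring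
  rw [hexp, hB, hB', hB] at h0
  have h1 : s * c n = a n := div_mul_cancel₀ _ hpos.ne'
  nlinarith [mul_nonneg hpos.le h0]

/-! ### The Müntz product -/

theorem Growth.exists_bounds {μ : ℕ → ℝ} {M β : ℝ} (hpos : ∀ n, 0 < μ n) (hM : 0 < M)
    (h : Growth μ M β) :
    ∃ c₁ c₂ : ℝ, 0 < c₁ ∧ 0 < c₂ ∧
      ∀ n : ℕ, c₁ * ((n : ℝ) + 1) ^ β ≤ μ n ∧ μ n ≤ c₂ * ((n : ℝ) + 1) ^ β := by
  obtain ⟨σ, hσ, -, ε, hμ, hε⟩ := h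
  have hpow : ∀ n : ℕ, 0 < ((n : ℝ) + 1) ^ β := fun n => Real.rpow_pos_of_pos (by positivity) _
  have hε0 : Filter.Tendsto ε Filter.atTop (nhds 0) :=
    hε.trans_tendsto ((tendsto_rpow_neg_atTop hσ).comp
      (Filter.tendsto_atTop_add_const_right _ _ tendsto_natCast_atTop_atTop))
  have hr : Filter.Tendsto (fun n => μ n / ((n : ℝ) + 1) ^ β) Filter.atTop (nhds M) := by
    have h1 : Filter.Tendsto (fun n => M * (1 + ε n)) Filter.atTop (nhds (M * (1 + 0))) :=
      (hε0.const_add 1).const_mul M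
    rw [add_zero, mul_one] at h1
    refine h1.congr fun n => ?_
    rw [hμ n, eq_div_iff (hpow n).ne']
    ring
  obtain ⟨b, hb⟩ := hr.bddAbove_range
  obtain ⟨d, hd⟩ := (hr.inv₀ hM.ne').bddAbove_range
  have hb' : ∀ n : ℕ, μ n / ((n : ℝ) + 1) ^ β ≤ b := fun n => hb ⟨n, rfl⟩
  have hd' : ∀ n : ℕ, (μ n / ((n : ℝ) + 1) ^ β)⁻¹ ≤ d := fun n => hd ⟨n, rfl⟩
  have hq : ∀ n : ℕ, 0 < μ n / ((n : ℝ) + 1) ^ β := fun n => div_pos (hpos n) (hpow n)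
  have hd0 : 0 < d := (inv_pos.2 (hq 0)).trans_le (hd' 0)
  refine ⟨d⁻¹, b, inv_pos.2 hd0, (hq 0).trans_le (hb' 0), fun n => ⟨?_, ?_⟩⟩
  · rw [← le_div_iff₀ (hpow n)]
    exact inv_le_of_inv_le₀ (hq n) (hd' n)
  · rw [← div_le_iff₀ (hpow n)]
    exact hb' n

theorem sum_Ico_rpow_neg_le {β : ℝ} (hβ : 1 < β) {p : ℕ} (hp : 0 < p) (N : ℕ) :
    ∑ k ∈ Finset.Ico p N, ((k : ℝ) + 1) ^ (-β) ≤ (p : ℝ) ^ (1 - β) / (β - 1) := by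
  have hp' : (0 : ℝ) < p := Nat.cast_pos.2 hp
  rcases le_total N p with h | h
  · rw [Finset.Ico_eq_empty_of_le h, Finset.sum_empty]
    exact div_nonneg (Real.rpow_nonneg hp'.le _) (by linarith)
  have hanti : AntitoneOn (fun x : ℝ => x ^ (-β)) (Set.Icc p N) := fun x hx y _ hxy =>
    Real.rpow_le_rpow_of_nonpos (hp'.trans_le hx.1) hxy (by linarith)
  have h1 := hanti.sum_le_integral_Ico h
  rw [integral_rpow (Or.inr ⟨by linarith, by
    rw [Set.uIcc_of_le (by exact_mod_cast h)]
    exact fun h0 => absurd h0.1 (not_le.2 hp')⟩)] at h1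
  have h2 : ∑ k ∈ Finset.Ico p N, ((k : ℝ) + 1) ^ (-β) =
      ∑ k ∈ Finset.Ico p N, ((k + 1 : ℕ) : ℝ) ^ (-β) := by simp
  rw [h2]
  refine h1.trans ?_
  rw [show -β + 1 = 1 - β by ring, ← neg_div_neg_eq, neg_sub, neg_sub]
  have h3 : (0 : ℝ) ≤ (N : ℝ) ^ (1 - β) := Real.rpow_nonneg (Nat.cast_nonneg _) _
  gcongr
  linarith

/-- The nearest neighbours of `μ n` are `μ (n - 1)` and `μ (n + 1)`, and `x ↦ x ^ (-s)` decreases,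
so the gap condition separates `μ n` from every other `μ k`. -/
theorem Gap.le_abs_sub {μ : ℕ → ℝ} (hmono : StrictMono μ) {θ s : ℝ} (hθ : 0 ≤ θ) (hs : 0 ≤ s)
    (h : ∀ n : ℕ, θ * ((n : ℝ) + 1) ^ (-s) ≤ μ (n + 1) - μ n) {n k : ℕ} (hk : k ≠ n) :
    θ * ((n : ℝ) + 1) ^ (-s) ≤ |μ n - μ k| := by
  rcases lt_or_gt_of_ne hk with hlt | hgt
  · obtain ⟨m, rfl⟩ : ∃ m, n = m + 1 := ⟨n - 1, by omega⟩
    have h1 := hmono.monotone (Nat.le_of_lt_succ hlt)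
    have h2 : (((m + 1 : ℕ) : ℝ) + 1) ^ (-s) ≤ ((m : ℝ) + 1) ^ (-s) :=
      Real.rpow_le_rpow_of_nonpos (by positivity) (by push_cast; linarith) (by linarith)
    have h3 := mul_le_mul_of_nonneg_left h2 hθ
    have h4 := h m
    exact le_trans (by linarith) (le_abs_self _)
  · have h1 := hmono.monotone (Nat.succ_le_of_lt hgt)
    have h4 := h n
    rw [abs_sub_comm]
    exact le_trans (by simp only [Nat.succ_eq_add_one] at h1; linarith) (le_abs_self _)

/-- The Müntz product is at most `e^{O(n log n)}`: the `O(n)` factors with index comparable to `n`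
are powers of `n` by the gap condition, and the others multiply to `e^{O(n)}` because
`∑_{k ≥ n} (n / k)^β = O(n)`. -/
theorem exists_prod_le {μ : ℕ → ℝ} {β c₁ c₂ : ℝ} (hpos : ∀ n, 0 < μ n) (hmono : StrictMono μ)
    (hβ : 1 < β) (hc₁ : 0 < c₁) (hc₂ : 0 < c₂)
    (hb : ∀ n : ℕ, c₁ * ((n : ℝ) + 1) ^ β ≤ μ n ∧ μ n ≤ c₂ * ((n : ℝ) + 1) ^ β) (hgap : Gap μ) :
    ∃ A B : ℝ, 0 < A ∧ 0 ≤ B ∧ ∀ (F : Finset ℕ) (n : ℕ),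
      ∏ k ∈ F.erase n, |(μ n + μ k) / (μ n - μ k)| ≤
        Real.exp (A * ((n : ℝ) + 1) * (Real.log ((n : ℝ) + 1) + B)) := by
  classical
  obtain ⟨θ, s, hθ, hs, hg⟩ := hgap
  have hβ0 : 0 < β := by linarith
  -- Indices from `L (n + 1)` on satisfy `μ_k ≥ 2 μ_n`.
  obtain ⟨L, hL1, hL⟩ : ∃ L : ℕ, 1 ≤ L ∧ 2 * c₂ / c₁ ≤ (L : ℝ) ^ β :=
    ((Filter.eventually_ge_atTop 1).and
      (((tendsto_rpow_atTop hβ0).comp tendsto_natCast_atTop_atTop).eventually_ge_atTop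
        (2 * c₂ / c₁))).exists
  have hLpos : (0 : ℝ) < L := by exact_mod_cast hL1
  set D : ℝ := 1 + c₂ * (1 + (L : ℝ) ^ β) / θ with hD
  have hLβ : 0 < (L : ℝ) ^ β := Real.rpow_pos_of_pos hLpos _
  have hD1 : 1 ≤ D := by
    have : 0 ≤ c₂ * (1 + (L : ℝ) ^ β) / θ := by positivity
    linarith
  have hlogD : 0 ≤ Real.log D := Real.log_nonneg hD1
  set E : ℝ := 4 * (c₂ / c₁) / (β - 1) with hE
  have hE0 : 0 ≤ E := div_nonneg (by positivity) (by linarith)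
  have hA : 0 < (L : ℝ) * (s + β) := by positivity
  refine ⟨L * (s + β), (L * Real.log D + E) / (L * (s + β)), hA, by positivity, fun F n => ?_⟩
  have hx : (1 : ℝ) ≤ (n : ℝ) + 1 := by linarith [(Nat.cast_nonneg n : (0 : ℝ) ≤ n)]
  set x : ℝ := (n : ℝ) + 1 with hxdef
  have hx0 : 0 < x := by linarith
  have hlogx : 0 ≤ Real.log x := Real.log_nonneg hx
  have hxβ : 0 < x ^ β := Real.rpow_pos_of_pos hx0 _
  have hne : ∀ k ∈ F.erase n, 0 < |μ n - μ k| := fun k hk =>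
    abs_pos.2 (sub_ne_zero.2 fun h => (Finset.mem_erase.1 hk).1 (hmono.injective h).symm)
  rw [← Finset.prod_filter_mul_prod_filter_not (F.erase n) (fun k => k < L * (n + 1))]
  have hnear : ∏ k ∈ (F.erase n).filter (fun k => k < L * (n + 1)),
      |(μ n + μ k) / (μ n - μ k)| ≤
        Real.exp (L * x * (Real.log D + (s + β) * Real.log x)) := by
    have hfac : ∀ k ∈ (F.erase n).filter (fun k => k < L * (n + 1)),
        |(μ n + μ k) / (μ n - μ k)| ≤ Real.exp (Real.log D + (s + β) * Real.log x) := by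
      intro k hk
      obtain ⟨hk1, hk2⟩ := Finset.mem_filter.1 hk
      have h1 := Gap.le_abs_sub hmono hθ.le hs hg (Finset.mem_erase.1 hk1).1
      rw [← hxdef] at h1
      have h2 : μ k ≤ c₂ * ((L : ℝ) ^ β * x ^ β) := by
        refine (hb k).2.trans (mul_le_mul_of_nonneg_left ?_ hc₂.le)
        rw [← Real.mul_rpow hLpos.le hx0.le]
        refine Real.rpow_le_rpow (by positivity) ?_ hβ0.le
        rw [hxdef]
        exact_mod_cast Nat.succ_le_of_lt hk2
      have h3 := (hb n).2
      rw [← hxdef] at h3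
      have hs0 : 0 < x ^ (-s) := Real.rpow_pos_of_pos hx0 _
      rw [abs_div, abs_of_pos (add_pos (hpos n) (hpos k)), Real.exp_add, Real.exp_log (by linarith),
        mul_comm (s + β), ← Real.rpow_def_of_pos hx0]
      calc (μ n + μ k) / |μ n - μ k|
          ≤ (c₂ * (1 + (L : ℝ) ^ β) * x ^ β) / (θ * x ^ (-s)) := by
            gcongr
            linarith
        _ = c₂ * (1 + (L : ℝ) ^ β) / θ * x ^ (s + β) := by
            rw [Real.rpow_neg hx0.le, Real.rpow_add hx0]
            field_simp
        _ ≤ D * x ^ (s + β) := by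
            gcongr
            linarith
    refine (Finset.prod_le_prod (fun _ _ => abs_nonneg _) hfac).trans ?_
    rw [Finset.prod_const, ← Real.exp_nat_mul]
    refine Real.exp_le_exp.2 (mul_le_mul_of_nonneg_right ?_ (by positivity))
    have hcard : ((F.erase n).filter (fun k => k < L * (n + 1))).card ≤ L * (n + 1) := by
      refine (Finset.card_le_card fun k hk => ?_).trans_eq (Finset.card_range _)
      exact Finset.mem_range.2 (Finset.mem_filter.1 hk).2
    rw [hxdef]
    exact_mod_cast hcard
  have hfar : ∏ k ∈ (F.erase n).filter (fun k => ¬k < L * (n + 1)),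
      |(μ n + μ k) / (μ n - μ k)| ≤ Real.exp (E * x) := by
    have hfac : ∀ k ∈ (F.erase n).filter (fun k => ¬k < L * (n + 1)),
        |(μ n + μ k) / (μ n - μ k)| ≤
          Real.exp (4 * (c₂ / c₁) * x ^ β * ((k : ℝ) + 1) ^ (-β)) := by
      intro k hk
      obtain ⟨hk1, hk2⟩ := Finset.mem_filter.1 hk
      have hkβ : 0 < ((k : ℝ) + 1) ^ β := Real.rpow_pos_of_pos (by positivity) _
      have h2 : 2 * μ n ≤ μ k := by
        have h3 : (L : ℝ) ^ β * x ^ β ≤ ((k : ℝ) + 1) ^ β := by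
          rw [← Real.mul_rpow hLpos.le hx0.le]
          refine Real.rpow_le_rpow (by positivity) ?_ hβ0.le
          rw [hxdef]
          exact_mod_cast (not_lt.1 hk2).trans (Nat.le_succ k)
        have h4 := (div_le_iff₀ hc₁).1 hL
        calc 2 * μ n ≤ 2 * c₂ * x ^ β := by linarith [(hb n).2]
          _ ≤ ((L : ℝ) ^ β * c₁) * x ^ β := by gcongr
          _ = c₁ * ((L : ℝ) ^ β * x ^ β) := by ring
          _ ≤ c₁ * ((k : ℝ) + 1) ^ β := by gcongr
          _ ≤ μ k := (hb k).1
      have hn0 := hpos n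
      have hk0 := hpos k
      have h5 : μ n / μ k ≤ c₂ / c₁ * x ^ β * ((k : ℝ) + 1) ^ (-β) := by
        rw [Real.rpow_neg (by positivity)]
        calc μ n / μ k ≤ (c₂ * x ^ β) / (c₁ * ((k : ℝ) + 1) ^ β) := by
              gcongr
              · exact (hb n).2
              · exact (hb k).1
          _ = _ := by field_simp
      have h6 : |(μ n + μ k) / (μ n - μ k)| ≤ 1 + 4 * (μ n / μ k) := by
        rw [abs_div, abs_of_pos (add_pos hn0 hk0), abs_of_neg (by linarith), neg_sub,
          div_le_iff₀ (by linarith)]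
        have h7 : (1 + 4 * (μ n / μ k)) * (μ k - μ n) =
            μ k - μ n + 4 * μ n - 4 * μ n * (μ n / μ k) := by
          field_simp
          ring
        have h8 : μ n / μ k ≤ 1 / 2 := by
          rw [div_le_iff₀ hk0]
          linarith
        rw [h7]
        nlinarith
      calc |(μ n + μ k) / (μ n - μ k)| ≤ 4 * (μ n / μ k) + 1 := by linarith
        _ ≤ Real.exp (4 * (μ n / μ k)) := Real.add_one_le_exp _
        _ ≤ _ := Real.exp_le_exp.2 (by linarith)
    refine (Finset.prod_le_prod (fun _ _ => abs_nonneg _) hfac).trans ?_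
    rw [← Real.exp_sum, ← Finset.mul_sum]
    refine Real.exp_le_exp.2 ?_
    have hsub : (F.erase n).filter (fun k => ¬k < L * (n + 1)) ⊆
        Finset.Ico (L * (n + 1)) (F.sup id + 1) := fun k hk => by
      obtain ⟨hk1, hk2⟩ := Finset.mem_filter.1 hk
      have : id k ≤ F.sup id := Finset.le_sup (Finset.mem_of_mem_erase hk1)
      exact Finset.mem_Ico.2 ⟨not_lt.1 hk2, Nat.lt_succ_of_le this⟩
    have hsum : ∑ k ∈ (F.erase n).filter (fun k => ¬k < L * (n + 1)), ((k : ℝ) + 1) ^ (-β) ≤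
        x ^ (1 - β) / (β - 1) := by
      refine (Finset.sum_le_sum_of_subset_of_nonneg hsub fun k _ _ =>
        Real.rpow_nonneg (by positivity) _).trans ?_
      refine (sum_Ico_rpow_neg_le hβ (by positivity) _).trans ?_
      refine div_le_div_of_nonneg_right ?_ (by linarith)
      refine Real.rpow_le_rpow_of_nonpos hx0 ?_ (by linarith)
      rw [hxdef]
      exact_mod_cast Nat.le_mul_of_pos_left _ hL1
    calc _ ≤ 4 * (c₂ / c₁) * x ^ β * (x ^ (1 - β) / (β - 1)) := by gcongr
      _ = E * (x ^ β * x ^ (1 - β)) := by rw [hE]; ring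
      _ = E * x := by rw [← Real.rpow_add hx0]; simp
  calc _ ≤ Real.exp (L * x * (Real.log D + (s + β) * Real.log x)) * Real.exp (E * x) :=
        mul_le_mul hnear hfar (Finset.prod_nonneg fun _ _ => abs_nonneg _) (Real.exp_nonneg _)
    _ = _ := by
        rw [← Real.exp_add]
        congr 1
        field_simp
        ring

/-- `√(2 μ_n)` times the bound of the Müntz product; it bounds the `n`-th coefficient of an
exponential polynomial of norm `1` in `L²(0, ∞)`. -/
noncomputable def coeffBound (μ : ℕ → ℝ) (A B : ℝ) (n : ℕ) : ℝ :=
  Real.sqrt (2 * μ n) * Real.exp (A * ((n : ℝ) + 1) * (Real.log ((n : ℝ) + 1) + B))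

theorem coeffBound_pos {μ : ℕ → ℝ} (hpos : ∀ n, 0 < μ n) (A B : ℝ) (n : ℕ) :
    0 < coeffBound μ A B n :=
  mul_pos (Real.sqrt_pos.2 (mul_pos two_pos (hpos n))) (Real.exp_pos _)

theorem abs_coeff_le {μ : ℕ → ℝ} (hpos : ∀ n, 0 < μ n) (hmono : StrictMono μ) {A B : ℝ}
    (hAB : ∀ (F : Finset ℕ) (n : ℕ), ∏ k ∈ F.erase n, |(μ n + μ k) / (μ n - μ k)| ≤
        Real.exp (A * ((n : ℝ) + 1) * (Real.log ((n : ℝ) + 1) + B)))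
    (a : ℕ →₀ ℝ) (n : ℕ) :
    |a n| ≤ coeffBound μ A B n * Real.sqrt (∫ t in Set.Ioi (0 : ℝ), expPoly μ a t ^ 2) := by
  by_cases hn : n ∈ a.support
  · have h := coeff_sq_le a.support (fun k _ => hpos k) hmono.injective.injOn hn a
    have h0 : 0 ≤ ∫ t in Set.Ioi (0 : ℝ), expPoly μ a t ^ 2 := integral_nonneg fun t => sq_nonneg _
    refine abs_le_of_sq_le_sq (h.trans ?_)
      (mul_nonneg (coeffBound_pos hpos A B n).le (Real.sqrt_nonneg _))
    rw [mul_pow, Real.sq_sqrt h0, coeffBound, mul_pow, Real.sq_sqrt (by linarith [hpos n]),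
      Finset.prod_pow, ← sq_abs (∏ k ∈ _, _), Finset.abs_prod]
    have h1 := hAB a.support n
    have h2 : 0 ≤ ∏ k ∈ a.support.erase n, |(μ n + μ k) / (μ n - μ k)| :=
      Finset.prod_nonneg fun _ _ => abs_nonneg _
    have h3 := hpos n
    exact mul_le_mul_of_nonneg_right (by gcongr) h0
  · rw [Finsupp.notMem_support_iff.1 hn, abs_zero]
    exact mul_nonneg (coeffBound_pos hpos A B n).le (Real.sqrt_nonneg _)

/-- As `n + 1 ≤ (μ_n / c₁)^{1/β}`, a bound `O(n log n)` is one in terms of `μ_n`. A large `K₂` makes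
`log μ_n + K₂` positive for the small `n`, where `log μ_n` may be negative. -/
theorem exists_le_weight_exponent {μ : ℕ → ℝ} {M β c₁ A B : ℝ} (hpos : ∀ n, 0 < μ n) (hM : 0 < M)
    (hβ : 1 < β) (hc₁ : 0 < c₁) (hb : ∀ n : ℕ, c₁ * ((n : ℝ) + 1) ^ β ≤ μ n) (hA : 0 < A)
    (hB : 0 ≤ B) :
    ∃ K₀ K₂ : ℝ, 0 < K₀ ∧ 0 < K₂ ∧ ∀ n : ℕ,
      A * ((n : ℝ) + 1) * (Real.log ((n : ℝ) + 1) + B) ≤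
        K₀ * M ^ (-(1 / β)) * μ n ^ (1 / β) * (Real.log (μ n) + K₂) := by
  have hβ0 : 0 < β := by linarith
  have hMp : 0 < M ^ (-(1 / β)) := Real.rpow_pos_of_pos hM _
  have hcp : 0 < c₁ ^ (1 / β) := Real.rpow_pos_of_pos hc₁ _
  refine ⟨A / (β * c₁ ^ (1 / β) * M ^ (-(1 / β))), max 1 (β * B - Real.log c₁), by positivity,
    lt_max_of_lt_left one_pos, fun n => ?_⟩
  have hx : (1 : ℝ) ≤ (n : ℝ) + 1 := by linarith [(Nat.cast_nonneg n : (0 : ℝ) ≤ n)]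
  set x : ℝ := (n : ℝ) + 1 with hxdef
  have hx0 : 0 < x := by linarith
  have hlogx : 0 ≤ Real.log x := Real.log_nonneg hx
  have hxβ : 0 < x ^ β := Real.rpow_pos_of_pos hx0 _
  have h1 : c₁ ^ (1 / β) * x ≤ μ n ^ (1 / β) := by
    calc c₁ ^ (1 / β) * x = (c₁ * x ^ β) ^ (1 / β) := by
          rw [Real.mul_rpow hc₁.le hxβ.le, ← Real.rpow_mul hx0.le, mul_one_div_cancel hβ0.ne',
            Real.rpow_one]
      _ ≤ _ := Real.rpow_le_rpow (by positivity) (hb n) (by positivity)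
  have h2 : β * (Real.log x + B) ≤ Real.log (μ n) + max 1 (β * B - Real.log c₁) := by
    have h3 := Real.log_le_log (by positivity) (hb n)
    rw [Real.log_mul hc₁.ne' hxβ.ne', Real.log_rpow hx0] at h3
    linarith [le_max_right 1 (β * B - Real.log c₁)]
  calc A * x * (Real.log x + B)
      = A / (β * c₁ ^ (1 / β) * M ^ (-(1 / β))) * M ^ (-(1 / β)) * (c₁ ^ (1 / β) * x) *
          (β * (Real.log x + B)) := by field_simp
    _ ≤ _ := by
        have := hpos n
        gcongr

/-- Since `β > 1`, the decay `e^{-μ_n δ}`, with `μ_n` of the order of `n^β`, beats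
`e^{O(n log n)}`. -/
theorem summable_coeffBound_mul_exp {μ : ℕ → ℝ} {β c₁ c₂ : ℝ} (hpos : ∀ n, 0 < μ n)
    (hβ : 1 < β) (hc₁ : 0 < c₁) (hc₂ : 0 < c₂)
    (hb : ∀ n : ℕ, c₁ * ((n : ℝ) + 1) ^ β ≤ μ n ∧ μ n ≤ c₂ * ((n : ℝ) + 1) ^ β) (A B : ℝ)
    {δ : ℝ} (hδ : 0 < δ) :
    Summable fun n => coeffBound μ A B n * Real.exp (-μ n * δ) := by
  have hβ0 : 0 < β := by linarith
  have hlog : Real.log =o[Filter.atTop] fun x : ℝ => x ^ β := isLittleO_log_rpow_atTop hβ0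
  have hone : ∀ c : ℝ, (fun _ : ℝ => c) =o[Filter.atTop] fun x : ℝ => x ^ β := fun c =>
    Asymptotics.isLittleO_const_left.2 (Or.inr
      (tendsto_norm_atTop_atTop.comp (tendsto_rpow_atTop hβ0)))
  have hid : ∀ f : ℝ → ℝ, f =o[Filter.atTop] (fun x : ℝ => x ^ (β - 1)) →
      (fun x => x * f x) =o[Filter.atTop] fun x : ℝ => x ^ β := fun f hf => by
    refine ((Asymptotics.isBigO_refl (fun x : ℝ => x) Filter.atTop).mul_isLittleO hf).congr'
      Filter.EventuallyEq.rfl ?_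
    filter_upwards [Filter.eventually_gt_atTop 0] with x hx
    rw [← Real.rpow_one_add' hx.le (by linarith)]
    congr 1
    ring
  have h1 : (fun x : ℝ => (Real.log (2 * c₂) + β * Real.log x) / 2 +
      A * (x * (Real.log x + B)) + x * 1) =o[Filter.atTop] fun x : ℝ => x ^ β := by
    have hβ1 : 0 < β - 1 := by linarith
    have hone' : ∀ c : ℝ, (fun _ : ℝ => c) =o[Filter.atTop] fun x : ℝ => x ^ (β - 1) := fun c =>
      Asymptotics.isLittleO_const_left.2 (Or.inr
        (tendsto_norm_atTop_atTop.comp (tendsto_rpow_atTop hβ1)))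
    refine ((Asymptotics.IsLittleO.add ?_ ?_).add (hid _ (hone' 1)))
    · simp_rw [div_eq_inv_mul]
      exact ((hone _).add (hlog.const_mul_left _)).const_mul_left _
    · exact (hid _ ((isLittleO_log_rpow_atTop hβ1).add (hone' B))).const_mul_left _
  have h2 := (Filter.tendsto_atTop_add_const_right _ (1 : ℝ)
    (tendsto_natCast_atTop_atTop (R := ℝ))).eventually (h1.bound (mul_pos hc₁ hδ))
  refine Summable.of_norm_bounded_eventually_nat Real.summable_exp_neg_nat ?_
  filter_upwards [h2] with n hn
  have hx : (1 : ℝ) ≤ (n : ℝ) + 1 := by linarith [(Nat.cast_nonneg n : (0 : ℝ) ≤ n)]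
  set x : ℝ := (n : ℝ) + 1 with hxdef
  have hx0 : 0 < x := by linarith
  have hxβ : 0 < x ^ β := Real.rpow_pos_of_pos hx0 _
  have hn0 := hpos n
  rw [Real.norm_of_nonneg hxβ.le] at hn
  have h3 := (le_abs_self _).trans hn
  rw [Real.norm_of_nonneg (mul_nonneg (coeffBound_pos hpos A B n).le (Real.exp_nonneg _)),
    coeffBound, ← hxdef, ← Real.exp_log (Real.sqrt_pos.2 (mul_pos two_pos hn0)), ← Real.exp_add,
    ← Real.exp_add, Real.log_sqrt (by positivity)]
  refine Real.exp_le_exp.2 ?_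
  have h4 : Real.log (2 * μ n) ≤ Real.log (2 * c₂) + β * Real.log x := by
    rw [← Real.log_rpow hx0, ← Real.log_mul (by positivity) hxβ.ne']
    exact Real.log_le_log (by positivity) (by linarith [(hb n).2])
  have h5 : c₁ * x ^ β * δ ≤ μ n * δ := by
    have := (hb n).1
    gcongr
  have h6 : A * x * (Real.log x + B) = A * (x * (Real.log x + B)) := by ring
  rw [h6]
  linarith

/-! ### Schwartz's inequality -/

section Compactness

variable {μ ω : ℕ → ℝ}

theorem abs_coeff_mul_exp_le (hmono : StrictMono μ) {b : ℕ → ℝ} (hb : ∀ n, |b n| ≤ ω n)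
    {δ t : ℝ} (ht : δ ≤ t) (n : ℕ) :
    |b n * Real.exp (-μ n * t)| ≤
      Real.exp (-μ 0 * (t - δ)) * (ω n * Real.exp (-μ n * δ)) := by
  have h0 : 0 ≤ ω n := (abs_nonneg _).trans (hb n)
  have h1 : Real.exp (-μ n * t) ≤ Real.exp (-μ 0 * (t - δ)) * Real.exp (-μ n * δ) := by
    rw [← Real.exp_add]
    refine Real.exp_le_exp.2 ?_
    have := mul_le_mul_of_nonneg_right (hmono.monotone (Nat.zero_le n)) (sub_nonneg.2 ht)
    linarith
  rw [abs_mul, Real.abs_exp]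
  calc |b n| * Real.exp (-μ n * t) ≤ ω n * (Real.exp (-μ 0 * (t - δ)) * Real.exp (-μ n * δ)) := by
        gcongr
        exact hb n
    _ = _ := by ring

theorem abs_expPoly_le (hmono : StrictMono μ)
    (hsum : ∀ δ : ℝ, 0 < δ → Summable fun n => ω n * Real.exp (-μ n * δ))
    {a : ℕ →₀ ℝ} (ha : ∀ n, |a n| ≤ ω n) {δ t : ℝ} (hδ : 0 < δ) (ht : δ ≤ t) :
    |expPoly μ a t| ≤ Real.exp (-μ 0 * (t - δ)) * ∑' n, ω n * Real.exp (-μ n * δ) := by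
  refine (Finset.abs_sum_le_sum_abs _ _).trans ?_
  refine (Finset.sum_le_sum fun n _ => abs_coeff_mul_exp_le hmono ha ht n).trans ?_
  rw [← Finset.mul_sum]
  refine mul_le_mul_of_nonneg_left ((hsum δ hδ).sum_le_tsum _ fun n _ => ?_) (Real.exp_nonneg _)
  exact mul_nonneg ((abs_nonneg _).trans (ha n)) (Real.exp_nonneg _)

theorem tendsto_expPoly (hmono : StrictMono μ)
    (hsum : ∀ δ : ℝ, 0 < δ → Summable fun n => ω n * Real.exp (-μ n * δ))
    {a : ℕ → ℕ →₀ ℝ} (ha : ∀ j n, |a j n| ≤ ω n) {b : ℕ → ℝ}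
    (hab : ∀ n, Filter.Tendsto (fun j => a j n) Filter.atTop (nhds (b n))) {t : ℝ} (ht : 0 < t) :
    Filter.Tendsto (fun j => expPoly μ (a j) t) Filter.atTop
      (nhds (∑' n, b n * Real.exp (-μ n * t))) := by
  have h : ∀ j, expPoly μ (a j) t = ∑' n, a j n * Real.exp (-μ n * t) := fun j => by
    rw [tsum_eq_sum (s := (a j).support)]
    · rfl
    · intro n hn
      rw [Finsupp.notMem_support_iff.1 hn, zero_mul]
  simp_rw [h]
  refine tendsto_tsum_of_dominated_convergence (hsum t ht) (fun n => (hab n).mul_const _)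
    (Filter.Eventually.of_forall fun j n => ?_)
  have := abs_coeff_mul_exp_le hmono (ha j) le_rfl (t := t) n
  simpa using this

/-- The bound `e^{-μ_0 (t - δ)} ∑ ω_n e^{-μ_n δ}` of the polynomials, uniform in `j` and
square-integrable on `(δ, ∞)`, justifies passing to the limit, even on unbounded sets. -/
theorem tendsto_setIntegral_expPoly_sq (hpos : 0 < μ 0) (hmono : StrictMono μ)
    (hsum : ∀ δ : ℝ, 0 < δ → Summable fun n => ω n * Real.exp (-μ n * δ))
    {a : ℕ → ℕ →₀ ℝ} (ha : ∀ j n, |a j n| ≤ ω n) {b : ℕ → ℝ}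
    (hab : ∀ n, Filter.Tendsto (fun j => a j n) Filter.atTop (nhds (b n)))
    {δ : ℝ} (hδ : 0 < δ) {s : Set ℝ} (hs : MeasurableSet s) (hsδ : s ⊆ Set.Ioi δ) :
    IntegrableOn (fun t => (∑' n, b n * Real.exp (-μ n * t)) ^ 2) s ∧
    Filter.Tendsto (fun j => ∫ t in s, expPoly μ (a j) t ^ 2) Filter.atTop
      (nhds (∫ t in s, (∑' n, b n * Real.exp (-μ n * t)) ^ 2)) := by
  set S : ℝ := ∑' n, ω n * Real.exp (-μ n * δ) with hS
  set g : ℝ → ℝ := fun t => (Real.exp (-μ 0 * (t - δ)) * S) ^ 2 with hg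
  have hgint : IntegrableOn g s := by
    have h1 := ((exp_neg_integrableOn_Ioi δ (mul_pos two_pos hpos)).mono_set hsδ).const_mul
      (Real.exp (2 * μ 0 * δ) * S ^ 2)
    refine h1.congr (Filter.Eventually.of_forall fun t => ?_)
    simp only [hg]
    rw [mul_pow, ← Real.exp_nat_mul, mul_right_comm, ← Real.exp_add]
    congr 2
    push_cast
    ring
  have hbound : ∀ j, ∀ t ∈ s, expPoly μ (a j) t ^ 2 ≤ g t := fun j t ht =>
    sq_le_sq.2 ((abs_expPoly_le hmono hsum (ha j) hδ (hsδ ht).le).trans (le_abs_self _))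
  have hlim : ∀ t ∈ s, Filter.Tendsto (fun j => expPoly μ (a j) t ^ 2) Filter.atTop
      (nhds ((∑' n, b n * Real.exp (-μ n * t)) ^ 2)) := fun t ht =>
    (tendsto_expPoly hmono hsum ha hab (hδ.trans (hsδ ht))).pow 2
  have hmeas : ∀ j, AEStronglyMeasurable (fun t => expPoly μ (a j) t ^ 2) (volume.restrict s) :=
    fun j => ((continuous_expPoly μ (a j)).pow 2).aestronglyMeasurable
  constructor
  · refine hgint.mono' (aestronglyMeasurable_of_tendsto_ae Filter.atTop hmeas
      ((ae_restrict_iff' hs).2 (Filter.Eventually.of_forall hlim))) ?_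
    refine (ae_restrict_iff' hs).2 (Filter.Eventually.of_forall fun t ht => ?_)
    rw [Real.norm_of_nonneg (sq_nonneg _)]
    exact le_of_tendsto' (hlim t ht) fun j => hbound j t ht
  · refine tendsto_integral_of_dominated_convergence g hmeas hgint (fun j => ?_)
      ((ae_restrict_iff' hs).2 (Filter.Eventually.of_forall hlim))
    refine (ae_restrict_iff' hs).2 (Filter.Eventually.of_forall fun t ht => ?_)
    rw [Real.norm_of_nonneg (sq_nonneg _)]
    exact hbound j t ht

/-- A Dirichlet series that converges absolutely in the right half plane is analytic there. -/
theorem analyticOnNhd_tsum_exp (hmono : StrictMono μ)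
    (hsum : ∀ δ : ℝ, 0 < δ → Summable fun n => ω n * Real.exp (-μ n * δ))
    (hpos : 0 < μ 0) {b : ℕ → ℝ} (hb : ∀ n, |b n| ≤ ω n) :
    AnalyticOnNhd ℂ (fun z : ℂ => ∑' n, (b n : ℂ) * Complex.exp (-(μ n : ℂ) * z))
      {z : ℂ | 0 < z.re} := by
  intro z hz
  have hz' : 0 < z.re := hz
  have hopen : IsOpen {w : ℂ | z.re / 2 < w.re} := isOpen_lt continuous_const Complex.continuous_re
  have hd : DifferentiableOn ℂ (fun z : ℂ => ∑' n, (b n : ℂ) * Complex.exp (-(μ n : ℂ) * z))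
      {w : ℂ | z.re / 2 < w.re} := by
    refine Complex.differentiableOn_tsum_of_summable_norm (hsum (z.re / 2) (by linarith))
      (fun n => by fun_prop) hopen fun n w hw => ?_
    have hw' : z.re / 2 < w.re := hw
    rw [norm_mul, Complex.norm_exp, Complex.norm_real, Real.norm_eq_abs]
    have h1 : (-(μ n : ℂ) * w).re = -μ n * w.re := by simp
    rw [h1]
    have h2 : 0 < μ n := hpos.trans_le (hmono.monotone (Nat.zero_le n))
    refine mul_le_mul (hb n) (Real.exp_le_exp.2 (by nlinarith)) (Real.exp_nonneg _)
      ((abs_nonneg _).trans (hb n))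
  exact hd.analyticAt (hopen.mem_nhds (by
    change z.re / 2 < z.re
    linarith))

/-- Uniqueness: the sum of the series is the trace on the real axis of an analytic function. -/
theorem tsum_exp_eq_zero_of_ae_eq_zero (hmono : StrictMono μ)
    (hsum : ∀ δ : ℝ, 0 < δ → Summable fun n => ω n * Real.exp (-μ n * δ))
    (hpos : 0 < μ 0) {b : ℕ → ℝ} (hb : ∀ n, |b n| ≤ ω n) {δ T : ℝ} (hδ : 0 < δ) (hδT : δ < T)
    (h : (fun t => ∑' n, b n * Real.exp (-μ n * t)) =ᵐ[volume.restrict (Set.Ioc δ T)] 0)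
    {t : ℝ} (ht : 0 < t) : ∑' n, b n * Real.exp (-μ n * t) = 0 := by
  set f : ℂ → ℂ := fun z => ∑' n, (b n : ℂ) * Complex.exp (-(μ n : ℂ) * z) with hf
  have han : AnalyticOnNhd ℂ f {z : ℂ | 0 < z.re} := analyticOnNhd_tsum_exp hmono hsum hpos hb
  have hreal : ∀ t : ℝ, f t = ((∑' n, b n * Real.exp (-μ n * t) : ℝ) : ℂ) := fun t => by
    rw [hf, Complex.ofReal_tsum]
    simp
  have hmaps : ∀ t : ℝ, 0 < t → (t : ℂ) ∈ {z : ℂ | 0 < z.re} := fun t ht => by simpa using ht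
  have hcont : ContinuousOn (fun t : ℝ => ∑' n, b n * Real.exp (-μ n * t)) (Set.Ioc δ T) := by
    have h1 : ContinuousOn (fun t : ℝ => (f t).re) (Set.Ioc δ T) :=
      Complex.continuous_re.comp_continuousOn (han.continuousOn.comp
        Complex.continuous_ofReal.continuousOn fun t ht => hmaps t (hδ.trans ht.1))
    refine h1.congr fun t _ => ?_
    simp only [hreal, Complex.ofReal_re]
  have heq := Measure.eqOn_Ioc_of_ae_eq _ h hcont continuousOn_const
  have hmid : δ < (δ + T) / 2 ∧ (δ + T) / 2 < T := ⟨by linarith, by linarith⟩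
  have hU : IsPreconnected {z : ℂ | 0 < z.re} := (convex_halfSpace_re_gt 0).isPreconnected
  have hfreq : ∃ᶠ z in nhdsWithin (((δ + T) / 2 : ℝ) : ℂ) {(((δ + T) / 2 : ℝ) : ℂ)}ᶜ,
      f z = (fun _ => (0 : ℂ)) z := by
    have h1 : Filter.Tendsto (fun t : ℝ => (t : ℂ)) (nhdsWithin ((δ + T) / 2) {(δ + T) / 2}ᶜ)
        (nhdsWithin (((δ + T) / 2 : ℝ) : ℂ) {(((δ + T) / 2 : ℝ) : ℂ)}ᶜ) :=
      tendsto_nhdsWithin_of_tendsto_nhds_of_eventually_within _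
        ((Complex.continuous_ofReal.tendsto _).mono_left nhdsWithin_le_nhds)
        (eventually_mem_nhdsWithin.mono fun t ht h0 => ht (Complex.ofReal_injective h0))
    refine h1.frequently (Filter.Eventually.frequently ?_)
    filter_upwards [nhdsWithin_le_nhds (Ioo_mem_nhds hmid.1 hmid.2)] with t ht
    have := heq ⟨ht.1, ht.2.le⟩
    simp only [Pi.zero_apply] at this
    rw [hreal, this, Complex.ofReal_zero]
  have h2 := han.eqOn_of_preconnected_of_frequently_eq analyticOnNhd_const hU
    (hmaps _ (by linarith)) hfreq (hmaps t ht)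
  rw [hreal] at h2
  exact Complex.ofReal_eq_zero.1 h2

/-- Schwartz's inequality: on exponential polynomials the norm of `L²(0, T)` dominates that of
`L²(0, ∞)`. Along a sequence of normalised counterexamples the coefficients, being bounded by `ω`,
converge after extraction; the limit is analytic and vanishes on a part of `(0, T)`, hence
everywhere, so the sequence tends to zero in `L²(0, ∞)` too. -/
theorem exists_integral_Ioi_le (hpos : 0 < μ 0) (hmono : StrictMono μ)
    (hsum : ∀ δ : ℝ, 0 < δ → Summable fun n => ω n * Real.exp (-μ n * δ))
    (hω : ∀ (a : ℕ →₀ ℝ) (n : ℕ),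
      |a n| ≤ ω n * Real.sqrt (∫ t in Set.Ioi (0 : ℝ), expPoly μ a t ^ 2))
    {T : ℝ} (hT : 0 < T) :
    ∃ C : ℝ, 0 < C ∧ ∀ a : ℕ →₀ ℝ,
      ∫ t in Set.Ioi (0 : ℝ), expPoly μ a t ^ 2 ≤ C * ∫ t in Set.Ioc 0 T, expPoly μ a t ^ 2 := by
  by_contra! hcon
  have hall : ∀ n, 0 < μ n := fun n => hpos.trans_le (hmono.monotone (Nat.zero_le n))
  have hnorm : ∀ j : ℕ, ∃ a : ℕ →₀ ℝ, ∫ t in Set.Ioi (0 : ℝ), expPoly μ a t ^ 2 = 1 ∧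
      ∫ t in Set.Ioc 0 T, expPoly μ a t ^ 2 ≤ 1 / ((j : ℝ) + 1) := by
    intro j
    obtain ⟨a, ha⟩ := hcon ((j : ℝ) + 1) (by positivity)
    set I : ℝ := ∫ t in Set.Ioi (0 : ℝ), expPoly μ a t ^ 2 with hI
    have hI0 : 0 < I := lt_of_le_of_lt
      (mul_nonneg (by positivity) (integral_nonneg fun t => sq_nonneg _)) ha
    have hscale : ∀ t, expPoly μ ((Real.sqrt I)⁻¹ • a) t ^ 2 = I⁻¹ * expPoly μ a t ^ 2 := by
      intro t
      rw [expPoly_eq_sum_of_subset μ _ Finsupp.support_smul, expPoly]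
      simp only [Finsupp.smul_apply, smul_eq_mul, mul_assoc]
      rw [← Finset.mul_sum, mul_pow, inv_pow, Real.sq_sqrt hI0.le]
    refine ⟨(Real.sqrt I)⁻¹ • a, ?_, ?_⟩
    · simp_rw [hscale]
      rw [integral_const_mul, ← hI, inv_mul_cancel₀ hI0.ne']
    · simp_rw [hscale]
      rw [integral_const_mul, inv_mul_le_iff₀ hI0, mul_one_div, le_div_iff₀ (by positivity)]
      linarith
  choose a ha1 ha2 using hnorm
  have hbd : ∀ j n, |a j n| ≤ ω n := fun j n => by
    have := hω (a j) n
    rwa [ha1, Real.sqrt_one, mul_one] at this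
  obtain ⟨b, hb, φ, hφ, hlim⟩ :=
    (isCompact_univ_pi fun n => isCompact_Icc (a := -ω n) (b := ω n)).isSeqCompact
      (x := fun j n => a j n) (fun j n _ => abs_le.1 (hbd j n))
  have hb' : ∀ n, |b n| ≤ ω n := fun n => abs_le.2 (hb n (Set.mem_univ n))
  have hlim' : ∀ n, Filter.Tendsto (fun j => a (φ j) n) Filter.atTop (nhds (b n)) :=
    tendsto_pi_nhds.1 hlim
  -- The coefficient bounds control the polynomials only away from `t = 0`, hence `T / 2`.
  have hδ : 0 < T / 2 := by linarith
  have hsmall : Filter.Tendsto (fun j => ∫ t in Set.Ioc 0 T, expPoly μ (a (φ j)) t ^ 2)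
      Filter.atTop (nhds 0) := by
    refine squeeze_zero (fun j => integral_nonneg fun t => sq_nonneg _) (fun j => ha2 (φ j)) ?_
    exact (tendsto_one_div_add_atTop_nhds_zero_nat (𝕜 := ℝ)).comp hφ.tendsto_atTop
  have hint : ∀ j, IntegrableOn (fun t => expPoly μ (a j) t ^ 2) (Set.Ioi 0) := fun j =>
    integrableOn_expPoly_sq hall (a j)
  obtain ⟨hfint, hfl⟩ := tendsto_setIntegral_expPoly_sq hpos hmono hsum (fun j => hbd (φ j)) hlim'
    hδ (s := Set.Ioc (T / 2) T) measurableSet_Ioc fun t ht => ht.1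
  have hzero : ∫ t in Set.Ioc (T / 2) T, (∑' n, b n * Real.exp (-μ n * t)) ^ 2 = 0 := by
    refine tendsto_nhds_unique hfl (squeeze_zero (fun j => integral_nonneg fun t => sq_nonneg _)
      (fun j => ?_) hsmall)
    exact setIntegral_mono_set ((hint (φ j)).mono_set Set.Ioc_subset_Ioi_self)
      (Filter.Eventually.of_forall fun t => sq_nonneg _)
      (Set.Ioc_subset_Ioc_left hδ.le).eventuallyLE
  have hae : (fun t => ∑' n, b n * Real.exp (-μ n * t)) =ᵐ[volume.restrict (Set.Ioc (T / 2) T)] 0 := by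
    have h1 := (integral_eq_zero_iff_of_nonneg (fun t => sq_nonneg _) hfint).1 hzero
    filter_upwards [h1] with t ht
    exact pow_eq_zero_iff two_ne_zero |>.1 ht
  have hvan : ∀ t : ℝ, 0 < t → ∑' n, b n * Real.exp (-μ n * t) = 0 := fun t ht =>
    tsum_exp_eq_zero_of_ae_eq_zero hmono hsum hpos hb' hδ (by linarith) hae ht
  have htail := (tendsto_setIntegral_expPoly_sq hpos hmono hsum (fun j => hbd (φ j)) hlim'
    hδ (s := Set.Ioi T) measurableSet_Ioi fun t ht => by
      have : T < t := ht
      change T / 2 < t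
      linarith).2
  rw [setIntegral_congr_fun measurableSet_Ioi (g := fun _ => (0 : ℝ)) fun t ht => by
    simp only
    rw [hvan t (hT.trans ht), sq, mul_zero], integral_zero] at htail
  have hone : ∀ j, (∫ t in Set.Ioc 0 T, expPoly μ (a (φ j)) t ^ 2) +
      ∫ t in Set.Ioi T, expPoly μ (a (φ j)) t ^ 2 = 1 := fun j => by
    rw [← ha1 (φ j), ← setIntegral_union Set.Ioc_disjoint_Ioi_same measurableSet_Ioi
      ((hint (φ j)).mono_set Set.Ioc_subset_Ioi_self)
      ((hint (φ j)).mono_set (Set.Ioi_subset_Ioi hT.le)), Set.Ioc_union_Ioi_eq_Ioi hT.le]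
  have h2 := hsmall.add htail
  simp_rw [hone] at h2
  have := tendsto_nhds_unique h2 tendsto_const_nhds
  norm_num at this

end Compactness

/-! ### The biorthogonal functions in `L²[0, T]` -/

section Hilbert

variable {𝕜 : Type*} [RCLike 𝕜]

theorem norm_sq_eq_integral {T : ℝ} (f : L2 𝕜 T) :
    ‖f‖ ^ 2 = ∫ t in Set.Icc (0 : ℝ) T, ‖f t‖ ^ 2 := by
  rw [← @inner_self_eq_norm_sq 𝕜, L2.inner_def, ← integral_re (L2.integrable_inner f f)]
  exact integral_congr_ae (Filter.Eventually.of_forall fun t => inner_self_eq_norm_sq _)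

theorem expIntegral_eq_inner {T : ℝ} (a : ℝ) (f : L2 𝕜 T) :
    expIntegral a f = inner 𝕜 (expL2 𝕜 T a) f := by
  rw [expIntegral, L2.inner_def]
  refine integral_congr_ae ?_
  filter_upwards [(memLp_exp 𝕜 T a).coeFn_toLp] with t ht
  rw [expL2, ht]
  simp [mul_comm]

theorem coeFn_linearCombination_expL2 (μ : ℕ → ℝ) (T : ℝ) (a : ℕ →₀ 𝕜) :
    (Finsupp.linearCombination 𝕜 (fun k => expL2 𝕜 T (μ k)) a : L2 𝕜 T)
      =ᵐ[volume.restrict (Set.Icc (0 : ℝ) T)]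
        fun t => ∑ k ∈ a.support, a k * ((Real.exp (-μ k * t) : ℝ) : 𝕜) := by
  rw [Finsupp.linearCombination_apply, Finsupp.sum]
  have h1 := Lp.coeFn_finsetSum a.support fun k => a k • expL2 𝕜 T (μ k)
  have h2 : ∀ᵐ t ∂(volume.restrict (Set.Icc (0 : ℝ) T)), ∀ k ∈ a.support,
      (a k • expL2 𝕜 T (μ k) : L2 𝕜 T) t = a k * ((Real.exp (-μ k * t) : ℝ) : 𝕜) := by
    refine (Finset.eventually_all _).2 fun k _ => ?_
    filter_upwards [Lp.coeFn_smul (a k) (expL2 𝕜 T (μ k)), (memLp_exp 𝕜 T (μ k)).coeFn_toLp]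
      with t ht1 ht2
    rw [ht1, Pi.smul_apply, smul_eq_mul, expL2, ht2]
  filter_upwards [h1, h2] with t ht1 ht2
  rw [ht1, Finset.sum_apply]
  exact Finset.sum_congr rfl ht2

/-- The norm of an exponential polynomial dominates that of its real part. -/
theorem integral_expPoly_sq_le_norm_sq (μ : ℕ → ℝ) (T : ℝ) (a : ℕ →₀ 𝕜) :
    ∫ t in Set.Ioc 0 T, expPoly μ (a.mapRange RCLike.re (by simp)) t ^ 2 ≤
      ‖Finsupp.linearCombination 𝕜 (fun k => expL2 𝕜 T (μ k)) a‖ ^ 2 := by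
  rw [norm_sq_eq_integral, ← integral_Icc_eq_integral_Ioc]
  refine integral_mono_ae (((continuous_expPoly μ _).pow 2).integrableOn_Icc) ?_ ?_
  · have := L2.integrable_inner (𝕜 := 𝕜) (Finsupp.linearCombination 𝕜 (fun k => expL2 𝕜 T (μ k)) a)
      (Finsupp.linearCombination 𝕜 (fun k => expL2 𝕜 T (μ k)) a)
    refine this.re.congr (Filter.Eventually.of_forall fun t => ?_)
    exact inner_self_eq_norm_sq _
  · filter_upwards [coeFn_linearCombination_expL2 μ T a] with t ht
    rw [ht, expPoly_eq_sum_of_subset μ _ Finsupp.support_mapRange]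
    have h1 : ∑ k ∈ a.support, (a.mapRange RCLike.re (by simp) : ℕ →₀ ℝ) k * Real.exp (-μ k * t) =
        RCLike.re (∑ k ∈ a.support, a k * ((Real.exp (-μ k * t) : ℝ) : 𝕜)) := by
      rw [map_sum]
      refine Finset.sum_congr rfl fun k _ => ?_
      rw [Finsupp.mapRange_apply, mul_comm (a k), RCLike.re_ofReal_mul, mul_comm]
    rw [h1, ← sq_abs]
    gcongr
    exact RCLike.abs_re_le_norm _

/-- A bound of the coefficients of real exponential polynomials by their norms in `L²(0, T)` bounds
the distance of `e^{-μ_n t}` to the closed span of the others from below: an element of the coset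
`e^{-μ_n t} - span` has `n`-th coefficient `1`, and so has its real part. -/
theorem one_le_mul_norm_residual {μ ω : ℕ → ℝ} {T C : ℝ}
    (hC : ∀ (a : ℕ →₀ ℝ) (n : ℕ),
      |a n| ≤ C * ω n * Real.sqrt (∫ t in Set.Ioc 0 T, expPoly μ a t ^ 2))
    (hCω : ∀ n, 0 ≤ C * ω n) (n : ℕ) :
    1 ≤ C * ω n * ‖residual 𝕜 μ T n‖ := by
  have hspan : ∀ v ∈ Submodule.span 𝕜 ((fun k => expL2 𝕜 T (μ k)) '' {k | k ≠ n}),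
      1 ≤ C * ω n * ‖expL2 𝕜 T (μ n) - v‖ := by
    intro v hv
    obtain ⟨l, hl, rfl⟩ := (Finsupp.mem_span_image_iff_linearCombination 𝕜).1 hv
    have hln : l n = 0 := by
      by_contra h
      exact hl (Finsupp.mem_support_iff.2 h) rfl
    have h1 : expL2 𝕜 T (μ n) - Finsupp.linearCombination 𝕜 (fun k => expL2 𝕜 T (μ k)) l =
        Finsupp.linearCombination 𝕜 (fun k => expL2 𝕜 T (μ k)) (Finsupp.single n 1 - l) := by
      rw [map_sub, Finsupp.linearCombination_single, one_smul]
    have h2 := hC ((Finsupp.single n 1 - l).mapRange RCLike.re (by simp)) n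
    rw [Finsupp.mapRange_apply, Finsupp.sub_apply, Finsupp.single_eq_same, hln, sub_zero,
      RCLike.one_re, abs_one] at h2
    rw [h1]
    refine h2.trans (mul_le_mul_of_nonneg_left ?_ (hCω n))
    exact Real.sqrt_le_iff.2 ⟨norm_nonneg _, integral_expPoly_sq_le_norm_sq μ T _⟩
  have hcl : IsClosed {v : L2 𝕜 T | 1 ≤ C * ω n * ‖expL2 𝕜 T (μ n) - v‖} :=
    isClosed_le continuous_const (by fun_prop)
  exact closure_minimal hspan hcl ((closedSpanOthers 𝕜 μ T n).starProjection_apply_mem _)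

theorem inner_expL2_residual (μ : ℕ → ℝ) (T : ℝ) (n k : ℕ) :
    inner 𝕜 (expL2 𝕜 T (μ n)) (residual 𝕜 μ T k) =
      if k = n then ((‖residual 𝕜 μ T k‖ ^ 2 : ℝ) : 𝕜) else 0 := by
  have horth : ∀ v ∈ closedSpanOthers 𝕜 μ T k, inner 𝕜 v (residual 𝕜 μ T k) = 0 :=
    (Submodule.mem_orthogonal _ _).1 (Submodule.sub_starProjection_mem_orthogonal _)
  split_ifs with h
  · subst h
    have h1 : expL2 𝕜 T (μ k) = residual 𝕜 μ T k +
        (closedSpanOthers 𝕜 μ T k).starProjection (expL2 𝕜 T (μ k)) := by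
      rw [residual, sub_add_cancel]
    rw [h1, inner_add_left, horth _ (Submodule.starProjection_apply_mem _ _), add_zero,
      inner_self_eq_norm_sq_to_K]
    push_cast
    rfl
  · exact horth _ (Submodule.le_topologicalClosure _ (Submodule.subset_span ⟨n, Ne.symm h, rfl⟩))

theorem norm_phi (μ : ℕ → ℝ) (T : ℝ) (n : ℕ) :
    ‖phi 𝕜 μ T n‖ = ‖residual 𝕜 μ T n‖⁻¹ := by
  rw [phi, norm_smul, RCLike.norm_ofReal, abs_of_nonneg (by positivity)]
  by_cases h : ‖residual 𝕜 μ T n‖ = 0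
  · simp [h]
  · field_simp

theorem expIntegral_phi {μ : ℕ → ℝ} {T : ℝ} {k : ℕ} (h : residual 𝕜 μ T k ≠ 0) (n : ℕ) :
    expIntegral (μ n) (phi 𝕜 μ T k) = if k = n then 1 else 0 := by
  rw [expIntegral_eq_inner, phi, inner_smul_right, inner_expL2_residual]
  have h1 : ‖residual 𝕜 μ T k‖ ≠ 0 := norm_ne_zero_iff.2 h
  split_ifs
  · rw [← RCLike.ofReal_mul, inv_mul_cancel₀ (pow_ne_zero 2 h1), RCLike.ofReal_one]
  · rw [mul_zero]

end Hilbert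

end ExpMoment

/-! ### The moment problem -/

theorem mainTheorem2 {𝕜 : Type*} [RCLike 𝕜] (μ : ℕ → ℝ) (M β : ℝ)
    (hpos : 0 < μ 0) (hmono : StrictMono μ) (hM : 0 < M) (hβ : 1 < β)
    (hgrowth : ExpMoment.Growth μ M β) (hgap : ExpMoment.Gap μ) :
    ∃ K₀ K₂ : ℝ, 0 < K₀ ∧ 0 < K₂ ∧ ∀ T : ℝ, 0 < T →
      (∀ k n : ℕ, ExpMoment.expIntegral (μ n) (ExpMoment.phi 𝕜 μ T k) = if k = n then 1 else 0) ∧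
      (∃ κ : ℝ, 0 < κ ∧ ∀ n : ℕ,
        ‖ExpMoment.phi 𝕜 μ T n‖ ≤ κ / Real.sqrt 2 * ExpMoment.weight μ M β K₀ K₂ n) ∧
      ∀ m : ℕ → 𝕜, Summable (fun n => ‖m n‖ * ExpMoment.weight μ M β K₀ K₂ n) →
        Summable (fun n => ‖m n‖ * ‖ExpMoment.phi 𝕜 μ T n‖) ∧
        ∃ ν : ExpMoment.L2 𝕜 T,
          HasSum (fun n => m n • ExpMoment.phi 𝕜 μ T n) ν ∧
          ∀ n : ℕ, ExpMoment.expIntegral (μ n) ν = m n := by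
  have hall : ∀ n, 0 < μ n := fun n => hpos.trans_le (hmono.monotone (Nat.zero_le n))
  obtain ⟨c₁, c₂, hc₁, hc₂, hb⟩ := hgrowth.exists_bounds hall hM
  obtain ⟨A, B, hA, hB, hprod⟩ := ExpMoment.exists_prod_le hall hmono hβ hc₁ hc₂ hb hgap
  obtain ⟨K₀, K₂, hK₀, hK₂, hK⟩ :=
    ExpMoment.exists_le_weight_exponent hall hM hβ hc₁ (fun n => (hb n).1) hA hB
  refine ⟨K₀, K₂, hK₀, hK₂, fun T hT => ?_⟩
  have hcoeff := ExpMoment.abs_coeff_le hall hmono hprod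
  obtain ⟨C, hC, hCT⟩ := ExpMoment.exists_integral_Ioi_le hpos hmono
    (fun δ hδ => ExpMoment.summable_coeffBound_mul_exp hall hβ hc₁ hc₂ hb A B hδ) hcoeff hT
  set ω : ℕ → ℝ := ExpMoment.coeffBound μ A B with hω
  have hω0 : ∀ n, 0 < ω n := ExpMoment.coeffBound_pos hall A B
  have hsC : 0 < Real.sqrt C := Real.sqrt_pos.2 hC
  have hres : ∀ n, 1 ≤ Real.sqrt C * ω n * ‖ExpMoment.residual 𝕜 μ T n‖ := by
    refine ExpMoment.one_le_mul_norm_residual (fun a n => (hcoeff a n).trans ?_)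
      fun n => (mul_pos hsC (hω0 n)).le
    rw [mul_comm (Real.sqrt C), mul_assoc, ← Real.sqrt_mul hC.le]
    exact mul_le_mul_of_nonneg_left (Real.sqrt_le_sqrt (hCT a)) (hω0 n).le
  have hres0 : ∀ n, ExpMoment.residual 𝕜 μ T n ≠ 0 := fun n h => by
    have := hres n
    rw [h, norm_zero, mul_zero] at this
    linarith
  have hbio := fun k n => ExpMoment.expIntegral_phi (hres0 k) (μ := μ) (T := T) n
  have hbound : ∀ n, ‖ExpMoment.phi 𝕜 μ T n‖ ≤
      2 * Real.sqrt C / Real.sqrt 2 * ExpMoment.weight μ M β K₀ K₂ n := fun n => by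
    have h2 : (0 : ℝ) < Real.sqrt 2 := Real.sqrt_pos.2 two_pos
    have h3 : 2 * Real.sqrt C / Real.sqrt 2 = Real.sqrt C * Real.sqrt 2 := by
      rw [div_eq_iff h2.ne', mul_assoc, Real.mul_self_sqrt two_pos.le, mul_comm]
    rw [ExpMoment.norm_phi, inv_le_iff_one_le_mul₀ (norm_pos_iff.2 (hres0 n)), h3]
    refine (hres n).trans (mul_le_mul_of_nonneg_right ?_ (norm_nonneg _))
    rw [hω, ExpMoment.coeffBound, ExpMoment.weight, Real.sqrt_mul two_pos.le, mul_assoc (√2),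
      ← mul_assoc (√C)]
    exact mul_le_mul_of_nonneg_left (mul_le_mul_of_nonneg_left (Real.exp_le_exp.2 (hK n))
      (Real.sqrt_nonneg _)) (by positivity)
  refine ⟨hbio, ⟨2 * Real.sqrt C, by positivity, hbound⟩, fun m hm => ?_⟩
  have hsum : Summable fun n => ‖m n‖ * ‖ExpMoment.phi 𝕜 μ T n‖ := by
    refine Summable.of_nonneg_of_le (fun n => by positivity) (fun n => ?_)
      (hm.mul_left (2 * Real.sqrt C / Real.sqrt 2))
    rw [mul_left_comm]
    exact mul_le_mul_of_nonneg_left (hbound n) (norm_nonneg _)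
  have hs : Summable fun n => m n • ExpMoment.phi 𝕜 μ T n :=
    Summable.of_norm (by simpa only [norm_smul] using hsum)
  refine ⟨hsum, _, hs.hasSum, fun n => ?_⟩
  have h1 := (innerSL 𝕜 (ExpMoment.expL2 𝕜 T (μ n))).hasSum hs.hasSum
  rw [ExpMoment.expIntegral_eq_inner]
  refine h1.unique ?_
  refine (hasSum_ite_eq n (m n)).congr_fun fun k => ?_
  rw [innerSL_apply_apply, inner_smul_right, ← ExpMoment.expIntegral_eq_inner, hbio]
  split_ifs with h <;> simp [h]
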